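/- For integers $r\ge 1$ and $n\ge 0$, a complete $r$-partite $r$-graph on a vertex set $V$ is an $r$-uniform hypergraph given by $r$ pairwise disjoint nonempty sets $V_1,\dots,V_r\subseteq V$ (not necessarily covering $V$), whose edges are exactly the $r$-element sets that contain precisely one vertex from each $V_i$. Let $f_r(n)$ be the minimum number of complete $r$-partite $r$-graphs on an $n$-element vertex set whose edge sets partition the edge set of the complete $r$-uniform hypergraph on that vertex set (the set of all its $r$-element subsets). Theorem 1. For every fixed even integer $r\ge 6$, $$f_r(n)\le \left(\tfrac{14}{15}\right)^{r/6}(1+o(1))\binom{n}{r/2}\qquad\text{as } n\to\infty,$$ that is, for every even $r\ge 6$ there is a real sequence $(\delta_n)$, which may depend on $r$, with $\delta_n\to 0$ as $n\to\infty$ and $f_r(n)\le (14/15)^{r/6}(1+\delta_n)\binom{n}{r/2}$ for all $n\ge 0$. -/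

import Mathlib

open Filter Topology

/-- An `r`-uniform hypergraph on the vertex set `V` is given by its edge set, a set of finite
subsets of `V`. These are the edges of the complete `r`-partite `r`-graph with vertex classes
`P 0, …, P (r - 1)`: all sets obtained by choosing precisely one vertex from each class. -/
def completePartiteEdges {V : Type*} [DecidableEq V] {r : ℕ} (P : Fin r → Finset V) :
    Set (Finset V) :=
  {e | ∃ v : Fin r → V, (∀ i, v i ∈ P i) ∧ e = Finset.univ.image v}

/-- `B` is (the edge set of) a complete `r`-partite `r`-graph whose vertices lie in `V`: its
vertex classes are nonempty and pairwise disjoint; they need not cover `V`. -/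
def IsBlock {V : Type*} [DecidableEq V] (r : ℕ) (B : Set (Finset V)) : Prop :=
  ∃ P : Fin r → Finset V, (∀ i, (P i).Nonempty) ∧ (∀ i j, i ≠ j → Disjoint (P i) (P j)) ∧
    B = completePartiteEdges P

/-- The edge set of the complete `r`-uniform hypergraph on `V`. -/
def completeHypergraph (V : Type*) (r : ℕ) : Set (Finset V) :=
  {e | e.card = r}

/-- The set `Γ` of complete `r`-partite `r`-graphs partitions the edge set `F`: its members are
edge-disjoint and the union of their edge sets is `F`. -/
def ExactlyCovers {V : Type*} [DecidableEq V] (r : ℕ) (Γ : Finset (Set (Finset V)))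
    (F : Set (Finset V)) : Prop :=
  (∀ B ∈ Γ, IsBlock r B) ∧ (∀ B ∈ Γ, ∀ C ∈ Γ, B ≠ C → Disjoint B C) ∧ (⋃ B ∈ Γ, B) = F

/-- `f_r(n)`: the minimum number of complete `r`-partite `r`-graphs that partition the edge set
of the complete `r`-uniform hypergraph on `n` vertices. -/
noncomputable def minBlocks (r n : ℕ) : ℕ :=
  sInf {k : ℕ | ∃ Γ : Finset (Set (Finset (Fin n))),
    ExactlyCovers r Γ (completeHypergraph (Fin n) r) ∧ Γ.card = k}

/-- A single edge of size `r` is a complete `r`-partite `r`-graph. -/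
theorem isBlock_singleton {V : Type*} [DecidableEq V] {r : ℕ} (e : Finset V) (he : e.card = r) :
    IsBlock r {e} := by
  let g : Fin r ≃ e := (e.equivFinOfCardEq he).symm
  refine ⟨fun i => {(g i : V)}, fun i => Finset.singleton_nonempty _, ?_, ?_⟩
  · intro i j hij
    rw [Finset.disjoint_singleton]
    intro h
    exact hij (g.injective (Subtype.ext h))
  · have him : Finset.univ.image (fun i => (g i : V)) = e := by
      ext x
      simp only [Finset.mem_image, Finset.mem_univ, true_and]
      constructor
      · rintro ⟨i, rfl⟩
        exact (g i).2
      · intro hx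
        exact ⟨g.symm ⟨x, hx⟩, by simp⟩
    ext s
    simp only [Set.mem_singleton_iff, completePartiteEdges, Set.mem_ofPred_eq,
      Finset.mem_singleton]
    constructor
    · rintro rfl
      exact ⟨fun i => (g i : V), fun i => rfl, him.symm⟩
    · rintro ⟨v, hv, rfl⟩
      rw [← him]
      congr 1
      exact funext hv

/-- The minimum that defines `minBlocks r n` is over a nonempty set, so it is attained. -/
theorem exists_exactlyCovers_card_eq_minBlocks (r n : ℕ) :
    ∃ Γ : Finset (Set (Finset (Fin n))),
      ExactlyCovers r Γ (completeHypergraph (Fin n) r) ∧ Γ.card = minBlocks r n := by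
  classical
  refine Nat.sInf_mem (s := {k : ℕ | ∃ Γ : Finset (Set (Finset (Fin n))),
    ExactlyCovers r Γ (completeHypergraph (Fin n) r) ∧ Γ.card = k}) ?_
  let Γ : Finset (Set (Finset (Fin n))) :=
    (Finset.powersetCard r Finset.univ).image (fun e => ({e} : Set (Finset (Fin n))))
  refine ⟨Γ.card, Γ, ⟨?_, ?_, ?_⟩, rfl⟩
  · intro B hB
    obtain ⟨e, he, rfl⟩ := Finset.mem_image.1 hB
    exact isBlock_singleton e (Finset.mem_powersetCard.1 he).2
  · intro B hB C hC hBC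
    obtain ⟨e, -, rfl⟩ := Finset.mem_image.1 hB
    obtain ⟨e', -, rfl⟩ := Finset.mem_image.1 hC
    rw [Set.disjoint_singleton]
    rintro rfl
    exact hBC rfl
  · ext e
    simp [Γ, completeHypergraph]

/-! Write r = 2k and split the n vertices into N color classes of size at most L, roughly n/N. The
type of an edge records how many vertices it takes from each class. The edges of one type form a
product over the classes, and decompositions on disjoint vertex sets multiply
(`HasDecomposition.edgeJoin`). The a-subsets of one class cost at most L^⌊a/2⌋ blocks
(`hasDecomposition_edgesOn`). Hence a type with an odd entry costs at most L^(k-1), which is of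
lower order, and any other type at most L^k.

The saving is made on the types that take two vertices from each of k classes. E(K₄) and E(K₆)
separately need 3 and 5 bicliques, but E(K₄) × E(K₆) splits into 14 < 3 · 5 products of bicliques.
The pairs inside a class split into blow-ups of K₄, or of K₆, so the ratio 14/15 carries over to any
two classes (`hasDecomposition_edgesOn_two_two`). Pairing up the k classes brings the cost of such a
type down to (14/15)^⌊k/2⌋ L^k.

Among the types with even entries these are almost all when N is large, and choose(N, k) · L^k is
then close to choose(n, k). So every constant above (14/15)^⌊k/2⌋ is eventually an upper bound for
the ratio of f_r(n) to choose(n, k), and ⌊k/2⌋ ≥ k/3 = r/6. -/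

/-! ### Calculus of partitions into weak blocks: unions and products. -/

section Decomposition

variable {V : Type*} [DecidableEq V]

/-- A complete `r`-partite `r`-graph whose vertex classes are allowed to be empty. -/
def IsWeakBlock (r : ℕ) (B : Set (Finset V)) : Prop :=
  ∃ P : Fin r → Finset V, (∀ i j, i ≠ j → Disjoint (P i) (P j)) ∧ B = completePartiteEdges P

/-- The edge set `F` is partitioned by at most `k` weak blocks of uniformity `r`. -/
def HasDecomposition (r : ℕ) (F : Set (Finset V)) (k : ℕ) : Prop :=
  ∃ Γ : Finset (Set (Finset V)), (∀ B ∈ Γ, IsWeakBlock r B) ∧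
    (∀ B ∈ Γ, ∀ C ∈ Γ, B ≠ C → Disjoint B C) ∧ (⋃ B ∈ Γ, B) = F ∧ Γ.card ≤ k

/-- All unions of an edge of `F` and an edge of `G`. -/
def edgeJoin (F G : Set (Finset V)) : Set (Finset V) :=
  Set.image2 (· ∪ ·) F G

theorem HasDecomposition.mono {r k l : ℕ} {F : Set (Finset V)} (h : HasDecomposition r F k)
    (hkl : k ≤ l) : HasDecomposition r F l := by
  obtain ⟨Γ, h1, h2, h3, h4⟩ := h
  exact ⟨Γ, h1, h2, h3, h4.trans hkl⟩

theorem IsWeakBlock.hasDecomposition {r : ℕ} {B : Set (Finset V)} (h : IsWeakBlock r B) :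
    HasDecomposition r B 1 := by
  classical
  refine ⟨{B}, ?_, ?_, ?_, by simp⟩
  · simpa using h
  · intro C hC D hD hCD
    rw [Finset.mem_singleton] at hC hD
    exact absurd (hC.trans hD.symm) hCD
  · simp

theorem HasDecomposition.empty (r k : ℕ) : HasDecomposition r (∅ : Set (Finset V)) k :=
  ⟨∅, by simp, by simp, by simp, by simp⟩

theorem HasDecomposition.union {r k l : ℕ} {F G : Set (Finset V)} (hF : HasDecomposition r F k)
    (hG : HasDecomposition r G l) (hd : Disjoint F G) : HasDecomposition r (F ∪ G) (k + l) := by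
  classical
  obtain ⟨Γ, h1, h2, rfl, h4⟩ := hF
  obtain ⟨Δ, g1, g2, rfl, g4⟩ := hG
  have key : ∀ B ∈ Γ, ∀ C ∈ Δ, Disjoint B C := fun B hB C hC =>
    hd.mono (Set.subset_biUnion_of_mem (u := fun B => B) hB)
      (Set.subset_biUnion_of_mem (u := fun B => B) hC)
  refine ⟨Γ ∪ Δ, ?_, ?_, ?_, (Finset.card_union_le _ _).trans (add_le_add h4 g4)⟩
  · intro B hB
    exact (Finset.mem_union.1 hB).elim (h1 B) (g1 B)
  · intro B hB C hC hBC
    rcases Finset.mem_union.1 hB with hB | hB <;> rcases Finset.mem_union.1 hC with hC | hC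
    · exact h2 B hB C hC hBC
    · exact key B hB C hC
    · exact (key C hC B hB).symm
    · exact g2 B hB C hC hBC
  · exact Finset.set_biUnion_union Γ Δ fun B => B

theorem HasDecomposition.biUnion {ι : Type*} {r : ℕ} (s : Finset ι) (F : ι → Set (Finset V))
    (k : ι → ℕ) (hF : ∀ i ∈ s, HasDecomposition r (F i) (k i))
    (hd : ∀ i ∈ s, ∀ j ∈ s, i ≠ j → Disjoint (F i) (F j)) :
    HasDecomposition r (⋃ i ∈ s, F i) (∑ i ∈ s, k i) := by
  classical
  induction s using Finset.induction_on with
  | empty => simpa using HasDecomposition.empty r 0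
  | insert a s ha ih =>
    rw [Finset.set_biUnion_insert, Finset.sum_insert ha]
    refine (hF a (Finset.mem_insert_self a s)).union
      (ih (fun i hi => hF i (Finset.mem_insert_of_mem hi)) fun i hi j hj =>
        hd i (Finset.mem_insert_of_mem hi) j (Finset.mem_insert_of_mem hj)) ?_
    rw [Set.disjoint_iUnion₂_right]
    intro i hi
    exact hd a (Finset.mem_insert_self a s) i (Finset.mem_insert_of_mem hi)
      (fun h => ha (h ▸ hi))

theorem completePartiteEdges_append {a b : ℕ} (P : Fin a → Finset V) (Q : Fin b → Finset V) :
    completePartiteEdges (Fin.append P Q) =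
      edgeJoin (completePartiteEdges P) (completePartiteEdges Q) := by
  have key : ∀ v : Fin (a + b) → V, Finset.univ.image v =
      Finset.univ.image (fun i => v (Fin.castAdd b i)) ∪
        Finset.univ.image (fun i => v (Fin.natAdd a i)) := by
    intro v
    ext x
    simp only [Finset.mem_image, Finset.mem_univ, true_and, Finset.mem_union]
    constructor
    · rintro ⟨i, rfl⟩
      refine Fin.addCases (fun i => Or.inl ⟨i, rfl⟩) (fun i => Or.inr ⟨i, rfl⟩) i
    · rintro (⟨i, rfl⟩ | ⟨i, rfl⟩) <;> exact ⟨_, rfl⟩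
  ext e
  constructor
  · rintro ⟨v, hv, rfl⟩
    refine ⟨_, ⟨fun i => v (Fin.castAdd b i), fun i => ?_, rfl⟩, _,
      ⟨fun i => v (Fin.natAdd a i), fun i => ?_, rfl⟩, (key v).symm⟩
    · simpa using hv (Fin.castAdd b i)
    · simpa using hv (Fin.natAdd a i)
  · rintro ⟨_, ⟨v, hv, rfl⟩, _, ⟨w, hw, rfl⟩, rfl⟩
    refine ⟨Fin.append v w, ?_, ?_⟩
    · intro i
      refine Fin.addCases (fun i => ?_) (fun i => ?_) i
      · simpa using hv i
      · simpa using hw i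
    · rw [key]
      simp

/-- When some class is empty there are no edges, and nothing forces the other classes into `U`.
Trimming all classes to `U` leaves the edge set unchanged. -/
theorem IsWeakBlock.exists_subset {r : ℕ} {B : Set (Finset V)} (h : IsWeakBlock r B)
    {U : Finset V} (hU : ∀ e ∈ B, e ⊆ U) :
    ∃ P : Fin r → Finset V, (∀ i, P i ⊆ U) ∧ (∀ i j, i ≠ j → Disjoint (P i) (P j)) ∧
      B = completePartiteEdges P := by
  obtain ⟨P, hP, rfl⟩ := h
  refine ⟨fun i => P i ∩ U, fun i => Finset.inter_subset_right, fun i j hij =>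
    (hP i j hij).mono Finset.inter_subset_left Finset.inter_subset_left, ?_⟩
  ext e
  constructor
  · intro he
    have heU := hU e he
    obtain ⟨v, hv, rfl⟩ := he
    exact ⟨v, fun i => Finset.mem_inter.2
      ⟨hv i, heU (Finset.mem_image_of_mem v (Finset.mem_univ i))⟩, rfl⟩
  · rintro ⟨v, hv, rfl⟩
    exact ⟨v, fun i => (Finset.mem_inter.1 (hv i)).1, rfl⟩

theorem IsWeakBlock.edgeJoin {a b : ℕ} {B C : Set (Finset V)} (hB : IsWeakBlock a B)
    (hC : IsWeakBlock b C) {U W : Finset V} (hBU : ∀ e ∈ B, e ⊆ U) (hCW : ∀ e ∈ C, e ⊆ W)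
    (hUW : Disjoint U W) : IsWeakBlock (a + b) (edgeJoin B C) := by
  obtain ⟨P, hPU, hP, rfl⟩ := hB.exists_subset hBU
  obtain ⟨Q, hQW, hQ, rfl⟩ := hC.exists_subset hCW
  refine ⟨Fin.append P Q, ?_, (completePartiteEdges_append P Q).symm⟩
  intro i j
  refine Fin.addCases (fun i => ?_) (fun i => ?_) i <;>
    refine Fin.addCases (fun j => ?_) (fun j => ?_) j <;> intro hij
  · simpa using hP i j fun h => hij (h ▸ rfl)
  · simpa using hUW.mono (hPU i) (hQW j)
  · simpa using (hUW.mono (hPU j) (hQW i)).symm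
  · simpa using hQ i j fun h => hij (h ▸ rfl)

theorem eq_and_eq_of_union_eq_union {U W e e' f f' : Finset V} (hUW : Disjoint U W) (he : e ⊆ U)
    (he' : e' ⊆ U) (hf : f ⊆ W) (hf' : f' ⊆ W) (h : e ∪ f = e' ∪ f') : e = e' ∧ f = f' := by
  have hU : ∀ {x}, x ∈ U → x ∉ W := fun hx => Finset.disjoint_left.1 hUW hx
  simp only [Finset.ext_iff, Finset.mem_union, Finset.subset_iff] at *
  constructor <;> intro x <;> have := @hU x <;> have := h x <;> have := @he x <;>
    have := @he' x <;> have := @hf x <;> have := @hf' x <;> tauto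

theorem edgeJoin_disjoint {F F' G G' : Set (Finset V)} {U W : Finset V} (hUW : Disjoint U W)
    (hF : ∀ e ∈ F, e ⊆ U) (hF' : ∀ e ∈ F', e ⊆ U) (hG : ∀ e ∈ G, e ⊆ W)
    (hG' : ∀ e ∈ G', e ⊆ W) (hd : Disjoint F F' ∨ Disjoint G G') :
    Disjoint (edgeJoin F G) (edgeJoin F' G') := by
  rw [Set.disjoint_left]
  rintro _ ⟨e, he, f, hf, rfl⟩ ⟨e', he', f', hf', h⟩
  obtain ⟨rfl, rfl⟩ := eq_and_eq_of_union_eq_union hUW (hF' _ he') (hF _ he) (hG' _ hf')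
    (hG _ hf) h
  rcases hd with hd | hd
  · exact Set.disjoint_left.1 hd he he'
  · exact Set.disjoint_left.1 hd hf hf'

/-- Since `U` and `W` are disjoint, a union determines its two parts, so the joins of one block from
each side are pairwise disjoint. -/
theorem HasDecomposition.edgeJoin {a b k l : ℕ} {F G : Set (Finset V)} {U W : Finset V}
    (hF : HasDecomposition a F k) (hG : HasDecomposition b G l) (hUW : Disjoint U W)
    (hFU : ∀ e ∈ F, e ⊆ U) (hGW : ∀ e ∈ G, e ⊆ W) :
    HasDecomposition (a + b) (edgeJoin F G) (k * l) := by
  classical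
  obtain ⟨Γ, h1, h2, rfl, h4⟩ := hF
  obtain ⟨Δ, g1, g2, rfl, g4⟩ := hG
  have hΓ : ∀ B ∈ Γ, ∀ e ∈ B, e ⊆ U := fun B hB e he => hFU e (Set.mem_biUnion hB he)
  have hΔ : ∀ B ∈ Δ, ∀ e ∈ B, e ⊆ W := fun B hB e he => hGW e (Set.mem_biUnion hB he)
  refine ⟨(Γ ×ˢ Δ).image fun p => _root_.edgeJoin p.1 p.2, ?_, ?_, ?_, ?_⟩
  · intro B hB
    obtain ⟨⟨C, D⟩, hp, rfl⟩ := Finset.mem_image.1 hB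
    obtain ⟨hC, hD⟩ := Finset.mem_product.1 hp
    exact (h1 C hC).edgeJoin (g1 D hD) (hΓ C hC) (hΔ D hD) hUW
  · intro B hB B' hB' hne
    obtain ⟨⟨C, D⟩, hp, rfl⟩ := Finset.mem_image.1 hB
    obtain ⟨⟨C', D'⟩, hp', rfl⟩ := Finset.mem_image.1 hB'
    obtain ⟨hC, hD⟩ := Finset.mem_product.1 hp
    obtain ⟨hC', hD'⟩ := Finset.mem_product.1 hp'
    refine edgeJoin_disjoint hUW (hΓ C hC) (hΓ C' hC') (hΔ D hD) (hΔ D' hD') ?_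
    by_cases hCC : C = C'
    · refine Or.inr (g2 D hD D' hD' ?_)
      rintro rfl
      exact hne (by rw [hCC])
    · exact Or.inl (h2 C hC C' hC' hCC)
  · ext x
    simp only [Finset.mem_image, Finset.mem_product, Set.mem_iUnion, exists_prop, Prod.exists,
      _root_.edgeJoin, Set.mem_image2]
    constructor
    · rintro ⟨_, ⟨C, D, ⟨hC, hD⟩, rfl⟩, e, he, f, hf, rfl⟩
      exact ⟨e, ⟨C, hC, he⟩, f, ⟨D, hD, hf⟩, rfl⟩
    · rintro ⟨e, ⟨C, hC, he⟩, f, ⟨D, hD, hf⟩, rfl⟩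
      exact ⟨_, ⟨C, D, ⟨hC, hD⟩, rfl⟩, e, he, f, hf, rfl⟩
  · exact Finset.card_image_le.trans ((Finset.card_product Γ Δ).le.trans (Nat.mul_le_mul h4 g4))

/-- A weak block with an empty class has no edges and can be discarded; the nonempty weak blocks are
genuine blocks. -/
theorem minBlocks_le_of_hasDecomposition {r n k : ℕ}
    (h : HasDecomposition r (completeHypergraph (Fin n) r) k) : minBlocks r n ≤ k := by
  classical
  obtain ⟨Γ, h1, h2, h3, h4⟩ := h
  suffices hΓ : ExactlyCovers r (Γ.filter fun B => B.Nonempty) (completeHypergraph (Fin n) r) by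
    refine (Nat.sInf_le ?_).trans ((Finset.card_filter_le Γ (fun B => B.Nonempty)).trans h4)
    exact ⟨_, hΓ, rfl⟩
  refine ⟨?_, ?_, ?_⟩
  · intro B hB
    obtain ⟨hB, e, he⟩ := Finset.mem_filter.1 hB
    obtain ⟨P, hP, rfl⟩ := h1 B hB
    obtain ⟨v, hv, -⟩ := he
    exact ⟨P, fun i => ⟨v i, hv i⟩, hP, rfl⟩
  · intro B hB C hC
    exact h2 B (Finset.mem_filter.1 hB).1 C (Finset.mem_filter.1 hC).1
  · rw [← h3]
    ext e
    simp only [Set.mem_iUnion, Finset.mem_filter, exists_prop]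
    exact ⟨fun ⟨B, hB, he⟩ => ⟨B, hB.1, he⟩, fun ⟨B, hB, he⟩ => ⟨B, ⟨hB, e, he⟩, he⟩⟩

end Decomposition

/-! ### Products of two complete graphs, with ratio 14/15. -/

section Pairs

variable {V : Type*}

/-- The edge set of the complete `a`-uniform hypergraph on the vertices in `U`. -/
def edgesOn (U : Finset V) (a : ℕ) : Set (Finset V) :=
  {e | e ⊆ U ∧ e.card = a}

theorem subset_of_mem_edgesOn {U : Finset V} {a : ℕ} : ∀ e ∈ edgesOn U a, e ⊆ U :=
  fun _ he => he.1

theorem edgesOn_two_eq_empty {U : Finset V} (hU : U.card ≤ 1) : edgesOn U 2 = ∅ := by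
  rw [Set.eq_empty_iff_forall_notMem]
  rintro e ⟨he, h2⟩
  have := Finset.card_le_card he
  omega

variable [DecidableEq V]

/-- The pairs in `U` that are not monochromatic in the coloring `κ`. -/
def separatedPairs {α : Type*} (U : Finset V) (κ : V → α) : Set (Finset V) :=
  {e | ∃ x ∈ U, ∃ y ∈ U, κ x ≠ κ y ∧ e = {x, y}}

/-- The complete bipartite graph between the vertices in `U` of colors `1` and `2`. -/
def bicliqueOn (U : Finset V) (χ : V → Fin 3) : Set (Finset V) :=
  {e | ∃ x ∈ U, ∃ y ∈ U, χ x = 1 ∧ χ y = 2 ∧ e = {x, y}}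

theorem isWeakBlock_bicliqueOn (U : Finset V) (χ : V → Fin 3) :
    IsWeakBlock 2 (bicliqueOn U χ) := by
  refine ⟨fun i => U.filter fun v => χ v = i.succ, ?_, ?_⟩
  · intro i j hij
    rw [Finset.disjoint_filter]
    intro x _ hi hj
    exact hij (Fin.succ_injective _ (hi.symm.trans hj))
  · ext e
    constructor
    · rintro ⟨x, hx, y, hy, h1, h2, rfl⟩
      refine ⟨![x, y], ?_, ?_⟩
      · intro i
        fin_cases i
        · simpa using ⟨hx, h1⟩
        · simpa using ⟨hy, h2⟩
      · ext z
        simp [Fin.exists_fin_two, eq_comm]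
    · rintro ⟨v, hv, rfl⟩
      have h0 := Finset.mem_filter.1 (hv 0)
      have h1 := Finset.mem_filter.1 (hv 1)
      refine ⟨v 0, h0.1, v 1, h1.1, h0.2, h1.2, ?_⟩
      ext z
      simp [Fin.exists_fin_two, eq_comm]

/-- Two of the colors `0, 1, 2` are `1` and `2`, in some order. -/
def oppositeColors (a b : Fin 3) : Bool := a.val + b.val == 3

theorem oppositeColors_iff :
    ∀ a b : Fin 3, oppositeColors a b = true ↔ (a = 1 ∧ b = 2) ∨ (a = 2 ∧ b = 1) := by
  decide

theorem pair_mem_bicliqueOn_iff {U : Finset V} {χ : V → Fin 3} {x y : V} (hx : x ∈ U)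
    (hy : y ∈ U) : {x, y} ∈ bicliqueOn U χ ↔ oppositeColors (χ x) (χ y) = true := by
  rw [oppositeColors_iff]
  constructor
  · rintro ⟨x', hx', y', hy', h1, h2, h⟩
    have hxx : x = x' ∨ x = y' := by
      have : x ∈ ({x', y'} : Finset V) := h ▸ Finset.mem_insert_self x {y}
      simpa using this
    have hyy : y = x' ∨ y = y' := by
      have : y ∈ ({x', y'} : Finset V) :=
        h ▸ Finset.mem_insert_of_mem (Finset.mem_singleton_self y)
      simpa using this
    have hx1 : x' = x ∨ x' = y := by
      have : x' ∈ ({x, y} : Finset V) := h ▸ Finset.mem_insert_self x' {y'}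
      simpa using this
    have hy1 : y' = x ∨ y' = y := by
      have : y' ∈ ({x, y} : Finset V) :=
        h ▸ Finset.mem_insert_of_mem (Finset.mem_singleton_self y')
      simpa using this
    have hne : x' ≠ y' := by
      rintro rfl
      rw [h1] at h2
      exact absurd h2 (by decide)
    rcases hx1 with rfl | rfl
    · rcases hy1 with rfl | rfl
      · exact absurd rfl hne
      · exact Or.inl ⟨h1, h2⟩
    · rcases hy1 with rfl | rfl
      · exact Or.inr ⟨h2, h1⟩
      · exact absurd rfl hne
  · rintro (⟨h1, h2⟩ | ⟨h1, h2⟩)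
    · exact ⟨x, hx, y, hy, h1, h2, rfl⟩
    · exact ⟨y, hy, x, hx, h2, h1, Finset.pair_comm x y⟩

theorem subset_of_mem_separatedPairs {α : Type*} {U : Finset V} {κ : V → α} :
    ∀ e ∈ separatedPairs U κ, e ⊆ U := by
  rintro _ ⟨x, hx, y, hy, -, rfl⟩
  simp [Finset.insert_subset_iff, hx, hy]

theorem subset_of_mem_bicliqueOn {U : Finset V} {χ : V → Fin 3} :
    ∀ e ∈ bicliqueOn U χ, e ⊆ U := by
  rintro _ ⟨x, hx, y, hy, -, -, rfl⟩
  simp [Finset.insert_subset_iff, hx, hy]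

/-- The first factors of a partition of `E(K₄) × E(K₆)` into `14` products of bicliques. -/
def bicliqueK4 : Fin 14 → Fin 4 → Fin 3 :=
  ![![1, 1, 2, 2], ![1, 1, 2, 2], ![1, 2, 0, 0], ![0, 0, 1, 2], ![1, 2, 1, 2], ![1, 2, 1, 2],
    ![1, 0, 2, 0], ![0, 1, 0, 2], ![1, 0, 2, 0], ![0, 1, 0, 2], ![1, 2, 2, 1], ![1, 2, 2, 1],
    ![1, 0, 0, 2], ![0, 1, 2, 0]]

/-- The second factors of a partition of `E(K₄) × E(K₆)` into `14` products of bicliques. -/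
def bicliqueK6 : Fin 14 → Fin 6 → Fin 3 :=
  ![![1, 0, 2, 0, 2, 0], ![0, 1, 0, 2, 2, 0], ![1, 1, 2, 2, 2, 0], ![1, 1, 2, 2, 2, 0],
    ![0, 2, 0, 2, 2, 1], ![0, 0, 2, 2, 1, 0], ![2, 0, 0, 1, 2, 2], ![2, 0, 0, 1, 2, 2],
    ![0, 1, 2, 0, 1, 2], ![0, 1, 2, 0, 1, 2], ![1, 2, 0, 0, 0, 2], ![0, 0, 1, 2, 0, 2],
    ![1, 2, 1, 2, 0, 2], ![1, 2, 1, 2, 0, 2]]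

/-- The `j`-th product of bicliques contains the pair of edges `ab` of `K₄` and `cd` of `K₆`. -/
def inBicliqueProduct (a b : Fin 4) (c d : Fin 6) (j : Fin 14) : Bool :=
  oppositeColors (bicliqueK4 j a) (bicliqueK4 j b) &&
    oppositeColors (bicliqueK6 j c) (bicliqueK6 j d)

/-- A finite check over the 6 · 15 pairs of edges. In the tables, colors 1 and 2 mark the two sides
of a biclique and 0 marks an unused vertex. -/
theorem card_inBicliqueProduct_of_lt : ∀ a b : Fin 4, a < b → ∀ c d : Fin 6, c < d →
    (Finset.univ.filter fun j => inBicliqueProduct a b c d j = true).card = 1 := by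
  decide +kernel

theorem inBicliqueProduct_swap_left (a b : Fin 4) (c d : Fin 6) :
    inBicliqueProduct a b c d = inBicliqueProduct b a c d := by
  funext j
  simp only [inBicliqueProduct, oppositeColors, Nat.add_comm]

theorem inBicliqueProduct_swap_right (a b : Fin 4) (c d : Fin 6) :
    inBicliqueProduct a b c d = inBicliqueProduct a b d c := by
  funext j
  simp only [inBicliqueProduct, oppositeColors, Nat.add_comm]

theorem existsUnique_inBicliqueProduct {a b : Fin 4} {c d : Fin 6} (hab : a ≠ b) (hcd : c ≠ d) :
    ∃! j, inBicliqueProduct a b c d j = true := by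
  have key : (Finset.univ.filter fun j => inBicliqueProduct a b c d j = true).card = 1 := by
    rcases lt_or_gt_of_ne hab with h | h <;> rcases lt_or_gt_of_ne hcd with h' | h'
    · exact card_inBicliqueProduct_of_lt a b h c d h'
    · rw [inBicliqueProduct_swap_right]
      exact card_inBicliqueProduct_of_lt a b h d c h'
    · rw [inBicliqueProduct_swap_left]
      exact card_inBicliqueProduct_of_lt b a h c d h'
    · rw [inBicliqueProduct_swap_left, inBicliqueProduct_swap_right]
      exact card_inBicliqueProduct_of_lt b a h d c h'
  obtain ⟨j, hj⟩ := Finset.card_eq_one.1 key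
  refine ⟨j, ?_, fun i hi => ?_⟩
  · have hmem : j ∈ Finset.univ.filter fun j => inBicliqueProduct a b c d j = true := by simp [hj]
    exact (Finset.mem_filter.1 hmem).2
  · exact Finset.mem_singleton.1 (hj ▸ Finset.mem_filter.2 ⟨Finset.mem_univ i, hi⟩)

/-- The 14 products are pulled back along the colorings `κ` and `μ`: separated pairs map to edges of
K₄ and K₆, and that pair of edges lies in exactly one product. -/
theorem hasDecomposition_separatedPairs {U W : Finset V} (hUW : Disjoint U W) (κ : V → Fin 4)
    (μ : V → Fin 6) :
    HasDecomposition 4 (edgeJoin (separatedPairs U κ) (separatedPairs W μ)) 14 := by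
  have hmem : ∀ j, ∀ x ∈ U, ∀ y ∈ U, ∀ z ∈ W, ∀ w ∈ W,
      (inBicliqueProduct (κ x) (κ y) (μ z) (μ w) j = true ↔
        ({x, y} ∈ bicliqueOn U (fun v => bicliqueK4 j (κ v)) ∧
          {z, w} ∈ bicliqueOn W (fun v => bicliqueK6 j (μ v)))) := by
    intro j x hx y hy z hz w hw
    rw [pair_mem_bicliqueOn_iff hx hy, pair_mem_bicliqueOn_iff hz hw, inBicliqueProduct,
      Bool.and_eq_true]
  have hsep : ∀ {α : Type} (S : Finset V) (ν : V → α) (c : α → Fin 3),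
      bicliqueOn S (fun v => c (ν v)) ⊆ separatedPairs S ν := by
    rintro α S ν c _ ⟨x, hx, y, hy, h1, h2, rfl⟩
    refine ⟨x, hx, y, hy, fun h => ?_, rfl⟩
    simp only [h, h2] at h1
    exact absurd h1 (by decide)
  have hdec := HasDecomposition.biUnion (r := 4) (Finset.univ : Finset (Fin 14))
    (fun j => edgeJoin (bicliqueOn U fun v => bicliqueK4 j (κ v))
      (bicliqueOn W fun v => bicliqueK6 j (μ v))) (fun _ => 1)
    (fun j _ => ((isWeakBlock_bicliqueOn _ _).edgeJoin (isWeakBlock_bicliqueOn _ _)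
      subset_of_mem_bicliqueOn subset_of_mem_bicliqueOn hUW).hasDecomposition) ?_
  · convert hdec using 1
    swap
    · simp
    ext e
    simp only [Finset.mem_univ, Set.iUnion_true, Set.mem_iUnion]
    constructor
    · rintro ⟨_, ⟨x, hx, y, hy, hxy, rfl⟩, _, ⟨z, hz, w, hw, hzw, rfl⟩, rfl⟩
      obtain ⟨j, hj, -⟩ := existsUnique_inBicliqueProduct hxy hzw
      obtain ⟨h1, h2⟩ := (hmem j x hx y hy z hz w hw).1 hj
      exact ⟨j, _, h1, _, h2, rfl⟩
    · rintro ⟨j, e, he, f, hf, rfl⟩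
      exact ⟨e, hsep _ _ _ he, f, hsep _ _ _ hf, rfl⟩
  · intro i _ j _ hij
    rw [Set.disjoint_left]
    rintro _ ⟨e, he, f, hf, rfl⟩ ⟨e', he', f', hf', h⟩
    obtain ⟨rfl, rfl⟩ := eq_and_eq_of_union_eq_union hUW (subset_of_mem_bicliqueOn _ he')
      (subset_of_mem_bicliqueOn _ he) (subset_of_mem_bicliqueOn _ hf')
      (subset_of_mem_bicliqueOn _ hf) h
    obtain ⟨x, hx, y, hy, hxy, rfl⟩ := hsep _ _ _ he
    obtain ⟨z, hz, w, hw, hzw, rfl⟩ := hsep _ _ _ hf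
    exact hij ((existsUnique_inBicliqueProduct hxy hzw).unique
      ((hmem i x hx y hy z hz w hw).2 ⟨he, hf⟩) ((hmem j x hx y hy z hz w hw).2 ⟨he', hf'⟩))

/-- Up to `q` vertices of `U` receive private colors, and all others share the last color and form
`U'`. The case `x = y` is excluded because a peeled vertex agrees with itself in color without lying
in `U'`. -/
theorem exists_coloring_peeling (q m : ℕ) (U : Finset V) (hU : U.card ≤ q + m) :
    ∃ (κ : V → Fin (q + 1)) (U' : Finset V), U' ⊆ U ∧ U'.card ≤ m ∧
      ∀ x ∈ U, ∀ y ∈ U, x ≠ y → (κ x = κ y ↔ x ∈ U' ∧ y ∈ U') := by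
  obtain ⟨T, hTU, hT⟩ := Finset.exists_subset_card_eq (min_le_right q U.card)
  have hTq : T.card ≤ q := hT.trans_le (min_le_left _ _)
  let f : T ↪ Fin q := T.equivFin.toEmbedding.trans (Fin.castLEEmb hTq)
  refine ⟨fun v => if h : v ∈ T then (f ⟨v, h⟩).castSucc else Fin.last q, U \ T,
    Finset.sdiff_subset, ?_, ?_⟩
  · rw [Finset.card_sdiff_of_subset hTU, hT]
    omega
  · intro x hx y hy hxy
    by_cases h1 : x ∈ T <;> by_cases h2 : y ∈ T
    · simp [h1, h2, hxy]
    · simp [h1, h2, hx, hy, Fin.castSucc_ne_last]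
    · simp [h1, h2, hx, hy, (Fin.castSucc_ne_last _).symm]
    · simp [h1, h2, hx, hy]

theorem exists_edgesOn_two_eq_union (q m : ℕ) (U : Finset V) (hU : U.card ≤ q + m) :
    ∃ (κ : V → Fin (q + 1)) (U' : Finset V), U' ⊆ U ∧ U'.card ≤ m ∧
      edgesOn U 2 = separatedPairs U κ ∪ edgesOn U' 2 ∧
      Disjoint (separatedPairs U κ) (edgesOn U' 2) := by
  obtain ⟨κ, U', hU', hm, h⟩ := exists_coloring_peeling q m U hU
  refine ⟨κ, U', hU', hm, ?_, ?_⟩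
  · ext e
    constructor
    · rintro ⟨heU, he⟩
      obtain ⟨x, y, hxy, rfl⟩ := Finset.card_eq_two.1 he
      have hx : x ∈ U := heU (by simp)
      have hy : y ∈ U := heU (by simp)
      by_cases hκ : κ x = κ y
      · obtain ⟨h1, h2⟩ := (h x hx y hy hxy).1 hκ
        exact Or.inr ⟨by simp [Finset.insert_subset_iff, h1, h2], he⟩
      · exact Or.inl ⟨x, hx, y, hy, hκ, rfl⟩
    · rintro (⟨x, hx, y, hy, hκ, rfl⟩ | ⟨he, h2⟩)
      · exact ⟨by simp [Finset.insert_subset_iff, hx, hy],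
          Finset.card_pair fun hxy => hκ (congrArg κ hxy)⟩
      · exact ⟨he.trans hU', h2⟩
  · rw [Set.disjoint_left]
    rintro _ ⟨x, hx, y, hy, hκ, rfl⟩ ⟨he, h2⟩
    exact hκ ((h x hx y hy fun hxy => hκ (congrArg κ hxy)).2 ⟨he (by simp), he (by simp)⟩)

/-- Peeling three vertices removes one blow-up of K₄ from the complete graph on `U`. After `s`
rounds at most one vertex is left, hence no pair. -/
theorem hasDecomposition_edgesOn_separatedPairs {W : Finset V} (μ : V → Fin 6) (s : ℕ) :
    ∀ U : Finset V, Disjoint U W → U.card ≤ 3 * s + 1 →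
      HasDecomposition 4 (edgeJoin (edgesOn U 2) (separatedPairs W μ)) (14 * s) := by
  induction s with
  | zero =>
    intro U _ hU
    rw [edgesOn_two_eq_empty hU, edgeJoin, Set.image2_empty_left]
    exact HasDecomposition.empty _ _
  | succ s ih =>
    intro U hUW hU
    obtain ⟨κ, U', hU', hm, heq, hd⟩ := exists_edgesOn_two_eq_union 3 (3 * s + 1) U (by omega)
    rw [heq, edgeJoin, Set.image2_union_left, Nat.mul_succ, Nat.add_comm _ 14]
    refine (hasDecomposition_separatedPairs hUW κ μ).union
      (ih U' (hUW.mono_left hU') hm) ?_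
    exact edgeJoin_disjoint hUW subset_of_mem_separatedPairs
      (fun e he => he.1.trans hU') subset_of_mem_separatedPairs subset_of_mem_separatedPairs
      (Or.inl hd)

/-- The same peeling on `W`, five vertices at a time, gives `t` blow-ups of K₆. Separate star
partitions of the two sides would cost 3s · 5t = 15st. -/
theorem hasDecomposition_edgesOn_two_two (s t : ℕ) {U : Finset V} (hU : U.card ≤ 3 * s + 1) :
    ∀ W : Finset V, Disjoint U W → W.card ≤ 5 * t + 1 →
      HasDecomposition 4 (edgeJoin (edgesOn U 2) (edgesOn W 2)) (14 * s * t) := by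
  induction t with
  | zero =>
    intro W _ hW
    rw [edgesOn_two_eq_empty hW, edgeJoin, Set.image2_empty_right]
    exact HasDecomposition.empty _ _
  | succ t ih =>
    intro W hUW hW
    obtain ⟨μ, W', hW', hm, heq, hd⟩ := exists_edgesOn_two_eq_union 5 (5 * t + 1) W (by omega)
    rw [heq, edgeJoin, Set.image2_union_right, Nat.mul_succ, Nat.add_comm _ (14 * s)]
    refine (hasDecomposition_edgesOn_separatedPairs μ s U hUW hU).union
      (ih W' (hUW.mono_right hW') hm) ?_
    exact edgeJoin_disjoint hUW subset_of_mem_edgesOn subset_of_mem_edgesOn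
      subset_of_mem_separatedPairs (fun e he => he.1.trans hW') (Or.inr hd)

end Pairs

/-! ### The elementary bound for the complete hypergraph on one class. -/

section Uniform

variable {V : Type*} [LinearOrder V]

theorem isWeakBlock_edgesOn_zero (U : Finset V) : IsWeakBlock 0 (edgesOn U 0) := by
  refine ⟨fun _ => ∅, fun i => i.elim0, ?_⟩
  ext e
  constructor
  · rintro ⟨-, he⟩
    exact ⟨fun i => i.elim0, fun i => i.elim0, by simpa using he⟩
  · rintro ⟨v, -, rfl⟩
    exact ⟨by simp, by simp⟩

theorem isWeakBlock_edgesOn_one (U : Finset V) : IsWeakBlock 1 (edgesOn U 1) := by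
  refine ⟨fun _ => U, fun i j hij => absurd (Subsingleton.elim i j) hij, ?_⟩
  ext e
  constructor
  · rintro ⟨heU, he⟩
    obtain ⟨x, rfl⟩ := Finset.card_eq_one.1 he
    exact ⟨fun _ => x, fun _ => heU (Finset.mem_singleton_self x), by simp⟩
  · rintro ⟨v, hv, rfl⟩
    exact ⟨by simpa using hv 0, by simp⟩

/-- The sets of size `a + 2` in `U` whose second smallest element is `y`. -/
def edgesOnWithSecond (U : Finset V) (a : ℕ) (y : V) : Set (Finset V) :=
  edgeJoin (bicliqueOn U fun v => if v < y then 1 else if v = y then 2 else 0)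
    (edgesOn (U.filter fun v => y < v) a)

theorem mem_edgesOnWithSecond {U : Finset V} {a : ℕ} {y : V} {e : Finset V} :
    e ∈ edgesOnWithSecond U a y ↔ ∃ x ∈ U, x < y ∧ y ∈ U ∧ ∃ f ⊆ U, (∀ v ∈ f, y < v) ∧
      f.card = a ∧ e = {x, y} ∪ f := by
  constructor
  · rintro ⟨_, ⟨x, hx, z, hz, h1, h2, rfl⟩, f, ⟨hf, hfa⟩, rfl⟩
    have hxy : x < y := by
      by_contra h
      by_cases h' : x = y <;> simp [h, h'] at h1
    have hzy : z = y := by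
      by_contra h
      by_cases h' : z < y <;> simp [h, h'] at h2
    subst hzy
    exact ⟨x, hx, hxy, hz, f, fun v hv => (Finset.mem_filter.1 (hf hv)).1,
      fun v hv => (Finset.mem_filter.1 (hf hv)).2, hfa, rfl⟩
  · rintro ⟨x, hx, hxy, hy, f, hfU, hf, hfa, rfl⟩
    exact ⟨_, ⟨x, hx, y, hy, by simp [hxy], by simp, rfl⟩, f,
      ⟨fun v hv => Finset.mem_filter.2 ⟨hfU hv, hf v hv⟩, hfa⟩, rfl⟩

theorem edgesOn_add_two (U : Finset V) (a : ℕ) :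
    edgesOn U (a + 2) = ⋃ y ∈ U, edgesOnWithSecond U a y := by
  ext e
  simp only [Set.mem_iUnion, mem_edgesOnWithSecond, exists_prop]
  constructor
  · rintro ⟨heU, he⟩
    have h1 : e.Nonempty := Finset.card_pos.1 (by omega)
    have hx := Finset.min'_mem e h1
    set x := e.min' h1 with hxdef
    have hc : (e.erase x).card = a + 1 := by rw [Finset.card_erase_of_mem hx]; omega
    have h2 : (e.erase x).Nonempty := Finset.card_pos.1 (by omega)
    have hy := Finset.min'_mem (e.erase x) h2
    set y := (e.erase x).min' h2 with hydef
    have hye : y ∈ e := Finset.mem_of_mem_erase hy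
    refine ⟨y, heU hye, x, heU hx, ?_, heU hye, (e.erase x).erase y, ?_, ?_, ?_, ?_⟩
    · exact lt_of_le_of_ne (Finset.min'_le e y hye) (Finset.ne_of_mem_erase hy).symm
    · exact ((Finset.erase_subset _ _).trans (Finset.erase_subset _ _)).trans heU
    · intro v hv
      exact lt_of_le_of_ne (Finset.min'_le _ v (Finset.mem_of_mem_erase hv))
        (Finset.ne_of_mem_erase hv).symm
    · rw [Finset.card_erase_of_mem hy, hc]
      rfl
    · rw [Finset.insert_union, Finset.singleton_union, Finset.insert_erase hy,
        Finset.insert_erase hx]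
  · rintro ⟨y, -, x, hx, hxy, hy, f, hfU, hf, hfa, rfl⟩
    refine ⟨Finset.union_subset (by simp [Finset.insert_subset_iff, hx, hy]) hfU, ?_⟩
    rw [Finset.card_union_of_disjoint, Finset.card_pair hxy.ne, hfa, Nat.add_comm]
    rw [Finset.disjoint_left]
    intro v hv hvf
    have := hf v hvf
    rcases Finset.mem_insert.1 hv with rfl | hv
    · exact lt_asymm this hxy
    · rw [Finset.mem_singleton.1 hv] at this
      exact lt_irrefl _ this

theorem disjoint_edgesOnWithSecond (U : Finset V) (a : ℕ) {y y' : V} (hne : y ≠ y') :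
    Disjoint (edgesOnWithSecond U a y) (edgesOnWithSecond U a y') := by
  wlog hlt : y < y' generalizing y y'
  · exact (this hne.symm (lt_of_le_of_ne (not_lt.1 hlt) hne.symm)).symm
  rw [Set.disjoint_left]
  intro e he he'
  obtain ⟨x, -, hxy, -, f, -, -, -, rfl⟩ := mem_edgesOnWithSecond.1 he
  obtain ⟨x', -, -, -, f', -, hf', -, h⟩ := mem_edgesOnWithSecond.1 he'
  -- Only one element of the set lies below `y'`, yet both `x` and `y` would.
  have key : ∀ z ∈ ({x, y} ∪ f : Finset V), z < y' → z = x' := by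
    intro z hz hzy
    rw [h, Finset.mem_union, Finset.mem_insert, Finset.mem_singleton] at hz
    rcases hz with (rfl | rfl) | hz
    · rfl
    · exact absurd hzy (lt_irrefl _)
    · exact absurd (hf' z hz) hzy.not_gt
  have h1 := key x (by simp) (hxy.trans hlt)
  have h2 := key y (by simp) hlt
  exact hxy.ne (h1.trans h2.symm)

/-- Fixing the second smallest element `y`, in at most `L` ways, leaves a biclique (the vertices
below `y` against `y`) joined with the `a`-sets above `y`. Two vertices thus cost one factor `L`,
and a last single vertex costs nothing. The bound is crude for large `a`, but types with an entry
above 2 will not affect the limit. -/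
theorem hasDecomposition_edgesOn {L : ℕ} : ∀ (a : ℕ) (U : Finset V), U.card ≤ L →
    HasDecomposition a (edgesOn U a) (L ^ (a / 2))
  | 0, U, _ => (isWeakBlock_edgesOn_zero U).hasDecomposition
  | 1, U, _ => (isWeakBlock_edgesOn_one U).hasDecomposition
  | a + 2, U, hU => by
    rw [edgesOn_add_two]
    refine (HasDecomposition.biUnion U (edgesOnWithSecond U a) (fun _ => L ^ (a / 2)) ?_
      fun y _ y' _ hne => disjoint_edgesOnWithSecond U a hne).mono ?_
    · intro y _
      have h := (isWeakBlock_bicliqueOn U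
        (fun v => if v < y then 1 else if v = y then 2 else 0)).hasDecomposition.edgeJoin
          (hasDecomposition_edgesOn a (U.filter fun v => y < v)
            ((Finset.card_filter_le _ _).trans hU)) (U := U.filter fun v => v ≤ y)
          (W := U.filter fun v => y < v) ?_ ?_ ?_
      · rwa [one_mul, Nat.add_comm] at h
      · rw [Finset.disjoint_filter]
        exact fun x _ h1 h2 => h1.not_gt h2
      · rintro _ ⟨x, hx, z, hz, h1, h2, rfl⟩
        have hxy : x < y := by
          by_contra h
          by_cases h' : x = y <;> simp [h, h'] at h1
        have hzy : z = y := by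
          by_contra h
          by_cases h' : z < y <;> simp [h, h'] at h2
        subst hzy
        simp [Finset.insert_subset_iff, hx, hz, hxy.le]
      · exact subset_of_mem_edgesOn
    · rw [Finset.sum_const, smul_eq_mul, Nat.add_div_right a two_pos, pow_succ, Nat.mul_comm]
      exact Nat.mul_le_mul_left _ hU

end Uniform

/-! ### Edges with a prescribed number of vertices in each color. -/

section Typed

set_option linter.unusedSectionVars false

variable {V ι : Type*} [LinearOrder V] [Fintype V] [DecidableEq ι]

/-- The sets of vertices with colors in `S` that contain `a i` vertices of each color `i ∈ S`. -/
def typedEdges (c : V → ι) (S : Finset ι) (a : ι → ℕ) : Set (Finset V) :=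
  {e | (∀ v ∈ e, c v ∈ S) ∧ ∀ i ∈ S, (e.filter fun v => c v = i).card = a i}

variable {c : V → ι}

theorem subset_of_mem_typedEdges {S : Finset ι} {a : ι → ℕ} :
    ∀ e ∈ typedEdges c S a, e ⊆ Finset.univ.filter fun v => c v ∈ S :=
  fun _ he v hv => Finset.mem_filter.2 ⟨Finset.mem_univ v, he.1 v hv⟩

theorem disjoint_filter_colors {S T : Finset ι} (hST : Disjoint S T) :
    Disjoint (Finset.univ.filter fun v => c v ∈ S) (Finset.univ.filter fun v => c v ∈ T) := by
  rw [Finset.disjoint_filter]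
  exact fun x _ h1 h2 => Finset.disjoint_left.1 hST h1 h2

theorem typedEdges_union {S T : Finset ι} (hST : Disjoint S T) (a : ι → ℕ) :
    typedEdges c (S ∪ T) a = edgeJoin (typedEdges c S a) (typedEdges c T a) := by
  ext e
  constructor
  · rintro ⟨h1, h2⟩
    refine ⟨e.filter fun v => c v ∈ S, ⟨fun v hv => (Finset.mem_filter.1 hv).2, ?_⟩,
      e.filter fun v => c v ∈ T, ⟨fun v hv => (Finset.mem_filter.1 hv).2, ?_⟩, ?_⟩
    · intro i hi
      rw [Finset.filter_filter, ← h2 i (Finset.mem_union_left T hi)]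
      congr 1
      ext v
      simp only [Finset.mem_filter]
      constructor
      · rintro ⟨hv, -, h⟩
        exact ⟨hv, h⟩
      · rintro ⟨hv, rfl⟩
        exact ⟨hv, hi, rfl⟩
    · intro i hi
      rw [Finset.filter_filter, ← h2 i (Finset.mem_union_right S hi)]
      congr 1
      ext v
      simp only [Finset.mem_filter]
      constructor
      · rintro ⟨hv, -, h⟩
        exact ⟨hv, h⟩
      · rintro ⟨hv, rfl⟩
        exact ⟨hv, hi, rfl⟩
    · ext v
      simp only [Finset.mem_union, Finset.mem_filter]
      constructor
      · rintro (h | h) <;> exact h.1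
      · intro hv
        exact (Finset.mem_union.1 (h1 v hv)).imp (fun h => ⟨hv, h⟩) fun h => ⟨hv, h⟩
  · rintro ⟨e, ⟨h1, h2⟩, f, ⟨g1, g2⟩, rfl⟩
    refine ⟨fun v hv => ?_, fun i hi => ?_⟩
    · exact Finset.mem_union.2 ((Finset.mem_union.1 hv).imp (h1 v) (g1 v))
    · rw [Finset.filter_union]
      rcases Finset.mem_union.1 hi with hi | hi
      · have hf : (f.filter fun v => c v = i) = ∅ := by
          rw [Finset.filter_eq_empty_iff]
          rintro v hv rfl
          exact Finset.disjoint_left.1 hST hi (g1 v hv)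
        rw [hf, Finset.union_empty, h2 i hi]
      · have hf : (e.filter fun v => c v = i) = ∅ := by
          rw [Finset.filter_eq_empty_iff]
          rintro v hv rfl
          exact Finset.disjoint_left.1 hST (h1 v hv) hi
        rw [hf, Finset.empty_union, g2 i hi]

theorem typedEdges_singleton (i : ι) (a : ι → ℕ) :
    typedEdges c {i} a = edgesOn (Finset.univ.filter fun v => c v = i) (a i) := by
  ext e
  constructor
  · rintro ⟨h1, h2⟩
    have h3 : ∀ v ∈ e, c v = i := fun v hv => Finset.mem_singleton.1 (h1 v hv)
    refine ⟨fun v hv => Finset.mem_filter.2 ⟨Finset.mem_univ v, h3 v hv⟩, ?_⟩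
    rw [← h2 i (Finset.mem_singleton_self i), Finset.filter_true_of_mem h3]
  · rintro ⟨h1, h2⟩
    have h3 : ∀ v ∈ e, c v = i := fun v hv => (Finset.mem_filter.1 (h1 hv)).2
    refine ⟨fun v hv => Finset.mem_singleton.2 (h3 v hv), fun j hj => ?_⟩
    rw [Finset.mem_singleton.1 hj, Finset.filter_true_of_mem h3, h2]

theorem typedEdges_empty (a : ι → ℕ) : typedEdges c ∅ a = edgesOn (∅ : Finset V) 0 := by
  ext e
  constructor
  · rintro ⟨h1, -⟩
    have : e = ∅ := Finset.eq_empty_of_forall_notMem fun v hv => absurd (h1 v hv) (by simp)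
    subst this
    exact ⟨by simp, by simp⟩
  · rintro ⟨-, h⟩
    rw [Finset.card_eq_zero.1 h]
    exact ⟨by simp, by simp⟩

theorem hasDecomposition_typedEdges {L : ℕ}
    (hL : ∀ i, (Finset.univ.filter fun v => c v = i).card ≤ L) (a : ι → ℕ) (S : Finset ι) :
    HasDecomposition (∑ i ∈ S, a i) (typedEdges c S a) (L ^ ∑ i ∈ S, a i / 2) := by
  induction S using Finset.induction_on with
  | empty =>
    rw [typedEdges_empty]
    exact (isWeakBlock_edgesOn_zero _).hasDecomposition
  | insert i S hi ih =>
    have hd : Disjoint {i} S := Finset.disjoint_singleton_left.2 hi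
    rw [Finset.insert_eq, typedEdges_union hd, Finset.sum_union hd, Finset.sum_union hd,
      Finset.sum_singleton, Finset.sum_singleton, pow_add]
    refine HasDecomposition.edgeJoin ?_ ih (disjoint_filter_colors hd)
      subset_of_mem_typedEdges subset_of_mem_typedEdges
    rw [typedEdges_singleton]
    exact hasDecomposition_edgesOn _ _ (hL i)

/-- Colors are removed two at a time, each pair costing 14st. If `k` is odd, one color remains and
costs `L`. -/
theorem hasDecomposition_typedEdges_two {s t L : ℕ}
    (hs : ∀ i, (Finset.univ.filter fun v => c v = i).card ≤ 3 * s + 1)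
    (ht : ∀ i, (Finset.univ.filter fun v => c v = i).card ≤ 5 * t + 1)
    (hL : ∀ i, (Finset.univ.filter fun v => c v = i).card ≤ L) :
    ∀ (k : ℕ) (S : Finset ι), S.card = k →
      HasDecomposition (2 * k) (typedEdges c S fun _ => 2)
        ((14 * s * t) ^ (k / 2) * L ^ (k % 2))
  | 0, S, hS => by
    rw [Finset.card_eq_zero.1 hS, typedEdges_empty]
    exact (isWeakBlock_edgesOn_zero _).hasDecomposition
  | 1, S, hS => by
    obtain ⟨i, rfl⟩ := Finset.card_eq_one.1 hS
    have h := hasDecomposition_typedEdges hL (fun _ => 2) {i}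
    simpa using h
  | k + 2, S, hS => by
    obtain ⟨i, hi⟩ : S.Nonempty := Finset.card_pos.1 (by omega)
    have hSi : (S.erase i).card = k + 1 := by rw [Finset.card_erase_of_mem hi]; omega
    obtain ⟨j, hj⟩ : (S.erase i).Nonempty := Finset.card_pos.1 (by omega)
    have hSj : ((S.erase i).erase j).card = k := by rw [Finset.card_erase_of_mem hj]; omega
    have hij : Disjoint ({i} : Finset ι) {j} :=
      Finset.disjoint_singleton.2 (Finset.ne_of_mem_erase hj).symm
    have hd : Disjoint ({i} ∪ {j}) ((S.erase i).erase j) := by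
      rw [Finset.disjoint_union_left]
      simp
    have hSeq : ({i} ∪ {j}) ∪ (S.erase i).erase j = S := by
      rw [Finset.union_assoc, ← Finset.insert_eq, ← Finset.insert_eq, Finset.insert_erase hj,
        Finset.insert_erase hi]
    have ih := hasDecomposition_typedEdges_two hs ht hL k _ hSj
    have hpair : HasDecomposition 4 (typedEdges c ({i} ∪ {j}) fun _ => 2) (14 * s * t) := by
      rw [typedEdges_union hij, typedEdges_singleton, typedEdges_singleton]
      refine hasDecomposition_edgesOn_two_two s t (hs i) _ ?_ (ht j)
      simpa using disjoint_filter_colors (c := c) hij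
    have h := hpair.edgeJoin ih (disjoint_filter_colors hd)
      subset_of_mem_typedEdges subset_of_mem_typedEdges
    rw [← typedEdges_union hd, hSeq] at h
    convert h using 1
    · omega
    · rw [Nat.add_div_right k two_pos, Nat.add_mod_right, pow_succ]
      ring

end Typed

/-! ### Summing the costs over all types. -/

section Counting

set_option linter.unusedSectionVars false

variable {V ι : Type*} [LinearOrder V] [Fintype V] [DecidableEq ι] [Fintype ι] {c : V → ι}

theorem completeHypergraph_eq_biUnion_typedEdges (c : V → ι) (r : ℕ) :
    completeHypergraph V r =
      ⋃ a ∈ Finset.piAntidiag (Finset.univ : Finset ι) r, typedEdges c Finset.univ a := by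
  have hsum : ∀ e : Finset V, e.card = ∑ i : ι, (e.filter fun v => c v = i).card := fun e =>
    Finset.card_eq_sum_card_fiberwise fun _ _ => Finset.mem_coe.2 (Finset.mem_univ _)
  ext e
  simp only [Set.mem_iUnion, exists_prop, Finset.mem_piAntidiag]
  constructor
  · intro he
    exact ⟨fun i => (e.filter fun v => c v = i).card, ⟨(hsum e).symm.trans he, by simp⟩,
      by simp, by simp⟩
  · rintro ⟨a, ⟨ha, -⟩, -, h⟩
    exact (hsum e).trans ((Finset.sum_congr rfl h).trans ha)

theorem disjoint_typedEdges_univ {a b : ι → ℕ} (hab : a ≠ b) :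
    Disjoint (typedEdges c Finset.univ a) (typedEdges c Finset.univ b) := by
  rw [Set.disjoint_left]
  rintro e ⟨-, h⟩ ⟨-, h'⟩
  exact hab (funext fun i => (h i (Finset.mem_univ i)).symm.trans (h' i (Finset.mem_univ i)))

/-- The type of the sets with two vertices in each color of `S` and no others. -/
def twoOn (S : Finset ι) (i : ι) : ℕ :=
  if i ∈ S then 2 else 0

theorem typedEdges_twoOn (S : Finset ι) :
    typedEdges c Finset.univ (twoOn S) = typedEdges c S fun _ => 2 := by
  ext e
  constructor
  · rintro ⟨-, h⟩
    refine ⟨fun v hv => ?_, fun i hi => ?_⟩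
    · by_contra hS
      have h0 := h (c v) (Finset.mem_univ _)
      rw [twoOn, if_neg hS, Finset.card_eq_zero] at h0
      have : v ∈ e.filter fun w => c w = c v := Finset.mem_filter.2 ⟨hv, rfl⟩
      rw [h0] at this
      exact absurd this (Finset.notMem_empty v)
    · rw [h i (Finset.mem_univ i), twoOn, if_pos hi]
  · rintro ⟨h1, h2⟩
    refine ⟨fun v _ => Finset.mem_univ _, fun i _ => ?_⟩
    by_cases hi : i ∈ S
    · rw [h2 i hi, twoOn, if_pos hi]
    · rw [twoOn, if_neg hi, Finset.card_eq_zero, Finset.filter_eq_empty_iff]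
      rintro v hv rfl
      exact hi (h1 v hv)

theorem twoOn_injective : Function.Injective (twoOn : Finset ι → ι → ℕ) := by
  intro S T h
  ext i
  have := congrFun h i
  by_cases h1 : i ∈ S <;> by_cases h2 : i ∈ T <;> simp_all [twoOn]

theorem sum_div_two_of_mem_image {k : ℕ} {a : ι → ℕ}
    (ha : a ∈ (Finset.piAntidiag (Finset.univ : Finset ι) k).image fun b i => 2 * b i) :
    ∑ i, a i / 2 = k := by
  obtain ⟨b, hb, rfl⟩ := Finset.mem_image.1 ha
  simpa using (Finset.mem_piAntidiag.1 hb).1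

/-- Twice the sum of the halves plus the number of odd entries equals 2k, so a single odd entry
makes the sum smaller than `k`. -/
theorem sum_div_two_lt_of_notMem_image {k : ℕ} {a : ι → ℕ} (hsum : ∑ i, a i = 2 * k)
    (ha : a ∉ (Finset.piAntidiag (Finset.univ : Finset ι) k).image fun b i => 2 * b i) :
    ∑ i, a i / 2 < k := by
  have h1 : 2 * ∑ i, a i / 2 + ∑ i, a i % 2 = 2 * k := by
    rw [Finset.mul_sum, ← Finset.sum_add_distrib, ← hsum]
    exact Finset.sum_congr rfl fun i _ => Nat.div_add_mod (a i) 2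
  by_contra! h2
  have h3 : ∑ i, a i % 2 = 0 := by omega
  refine ha (Finset.mem_image.2 ⟨fun i => a i / 2, Finset.mem_piAntidiag.2 ⟨by omega, by simp⟩, ?_⟩)
  funext i
  have := Finset.sum_eq_zero_iff.1 h3 i (Finset.mem_univ i)
  dsimp only
  omega

/-- The three summands correspond to the types with entries in {0, 2} (`G`), the remaining even
types (`E \ G`), and the types with an odd entry (`A \ E`). -/
theorem hasDecomposition_completeHypergraph {s t L k : ℕ} (hL1 : 1 ≤ L)
    (hs : ∀ i, (Finset.univ.filter fun v => c v = i).card ≤ 3 * s + 1)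
    (ht : ∀ i, (Finset.univ.filter fun v => c v = i).card ≤ 5 * t + 1)
    (hL : ∀ i, (Finset.univ.filter fun v => c v = i).card ≤ L) :
    HasDecomposition (2 * k) (completeHypergraph V (2 * k))
      ((Fintype.card ι).choose k * ((14 * s * t) ^ (k / 2) * L ^ (k % 2)) +
        ((Finset.piAntidiag (Finset.univ : Finset ι) k).card - (Fintype.card ι).choose k) * L ^ k +
        (Finset.piAntidiag (Finset.univ : Finset ι) (2 * k)).card * L ^ (k - 1)) := by
  set A := Finset.piAntidiag (Finset.univ : Finset ι) (2 * k) with hA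
  set E := (Finset.piAntidiag (Finset.univ : Finset ι) k).image fun b i => 2 * b i with hE
  set G := (Finset.powersetCard k (Finset.univ : Finset ι)).image twoOn with hG
  set g := (14 * s * t) ^ (k / 2) * L ^ (k % 2) with hg
  have hGcard : G.card = (Fintype.card ι).choose k := by
    rw [hG, Finset.card_image_of_injective _ twoOn_injective, Finset.card_powersetCard,
      Finset.card_univ]
  have hEcard : E.card = (Finset.piAntidiag (Finset.univ : Finset ι) k).card := by
    refine Finset.card_image_of_injective _ fun b b' h => funext fun i => ?_
    have := congrFun h i
    simpa using this
  have hGE : G ⊆ E := by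
    intro a ha
    obtain ⟨S, hS, rfl⟩ := Finset.mem_image.1 ha
    refine Finset.mem_image.2 ⟨fun i => if i ∈ S then 1 else 0, ?_, ?_⟩
    · simpa using (Finset.mem_powersetCard.1 hS).2
    · funext i
      by_cases hi : i ∈ S <;> simp [twoOn, hi]
  have hEA : E ⊆ A := by
    intro a ha
    obtain ⟨b, hb, rfl⟩ := Finset.mem_image.1 ha
    refine Finset.mem_piAntidiag.2 ⟨?_, by simp⟩
    rw [← Finset.mul_sum, (Finset.mem_piAntidiag.1 hb).1]
  have hdec := HasDecomposition.biUnion (r := 2 * k) A (typedEdges c Finset.univ)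
    (fun a => if a ∈ G then g else L ^ ∑ i, a i / 2) ?_
    fun a _ b _ hab => disjoint_typedEdges_univ hab
  · rw [← completeHypergraph_eq_biUnion_typedEdges] at hdec
    refine hdec.mono ?_
    rw [← Finset.sum_sdiff hEA, ← Finset.sum_sdiff hGE]
    have h1 : ∑ a ∈ A \ E, (if a ∈ G then g else L ^ ∑ i, a i / 2) ≤ A.card * L ^ (k - 1) := by
      refine (Finset.sum_le_card_nsmul _ _ (L ^ (k - 1)) fun a ha => ?_).trans
        (Nat.mul_le_mul_right _ (Finset.card_le_card Finset.sdiff_subset))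
      obtain ⟨haA, haE⟩ := Finset.mem_sdiff.1 ha
      rw [if_neg fun h => haE (hGE h)]
      have := sum_div_two_lt_of_notMem_image (Finset.mem_piAntidiag.1 haA).1 haE
      exact Nat.pow_le_pow_right hL1 (by omega)
    have h2 : ∑ a ∈ E \ G, (if a ∈ G then g else L ^ ∑ i, a i / 2) =
        (E.card - G.card) * L ^ k := by
      rw [← Finset.card_sdiff_of_subset hGE, ← smul_eq_mul, ← Finset.sum_const]
      refine Finset.sum_congr rfl fun a ha => ?_
      obtain ⟨haE, haG⟩ := Finset.mem_sdiff.1 ha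
      rw [if_neg haG, sum_div_two_of_mem_image haE]
    have h3 : ∑ a ∈ G, (if a ∈ G then g else L ^ ∑ i, a i / 2) = G.card * g := by
      rw [← smul_eq_mul, ← Finset.sum_const]
      exact Finset.sum_congr rfl fun a ha => if_pos ha
    rw [h2, h3, hEcard, hGcard]
    omega
  · intro a ha
    by_cases haG : a ∈ G
    · obtain ⟨S, hS, rfl⟩ := Finset.mem_image.1 haG
      simp only [if_pos haG]
      rw [typedEdges_twoOn]
      exact hasDecomposition_typedEdges_two hs ht hL k S (Finset.mem_powersetCard.1 hS).2
    · simp only [if_neg haG]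
      have h := hasDecomposition_typedEdges hL a Finset.univ
      rwa [(Finset.mem_piAntidiag.1 ha).1] at h

theorem card_piAntidiag_univ (k : ℕ) :
    (Finset.piAntidiag (Finset.univ : Finset ι) k).card = (Fintype.card ι).multichoose k := by
  rw [← Finset.map_sym_eq_piAntidiag, Finset.card_map, Finset.sym_univ, Finset.card_univ,
    Sym.card_sym_eq_multichoose]

end Counting

/-! ### Explicit bounds for a fixed number of color classes. -/

/-- The colors are intervals of length 15m + 1. This length equals both 3s + 1 and 5t + 1 for s = 5m
and t = 3m, and then 14st = 210m². -/
theorem minBlocks_le (k N m n : ℕ) (hn : n ≤ N * (15 * m + 1)) :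
    minBlocks (2 * k) n ≤ N.choose k * ((210 * m ^ 2) ^ (k / 2) * (15 * m + 1) ^ (k % 2)) +
      (N.multichoose k - N.choose k) * (15 * m + 1) ^ k +
      N.multichoose (2 * k) * (15 * m + 1) ^ (k - 1) := by
  let c : Fin n → Fin N := fun v =>
    ⟨v / (15 * m + 1), by
      rw [Nat.div_lt_iff_lt_mul (by omega)]
      exact v.2.trans_le hn⟩
  have hc : ∀ i, (Finset.univ.filter fun v => c v = i).card ≤ 15 * m + 1 := by
    intro i
    rw [← Finset.card_range (15 * m + 1)]
    refine Finset.card_le_card_of_injOn (fun v => v.val % (15 * m + 1)) ?_ ?_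
    · intro v _
      exact Finset.mem_coe.2 (Finset.mem_range.2 (Nat.mod_lt _ (by omega)))
    · intro v hv w hw h
      have h1 := (Finset.mem_filter.1 (Finset.mem_coe.1 hv)).2
      have h2 := (Finset.mem_filter.1 (Finset.mem_coe.1 hw)).2
      have h3 : v.val / (15 * m + 1) = w.val / (15 * m + 1) :=
        congrArg Fin.val (h1.trans h2.symm)
      have h4 : v.val % (15 * m + 1) = w.val % (15 * m + 1) := h
      refine Fin.ext ?_
      rw [← Nat.div_add_mod v.val (15 * m + 1), h3, h4, Nat.div_add_mod]
  have h := hasDecomposition_completeHypergraph (c := c) (s := 5 * m) (t := 3 * m)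
    (L := 15 * m + 1) (k := k) (by omega) (fun i => (hc i).trans (by omega))
    (fun i => (hc i).trans (by omega)) hc
  have h' := minBlocks_le_of_hasDecomposition h
  rw [card_piAntidiag_univ, card_piAntidiag_univ, Fintype.card_fin] at h'
  convert h' using 5
  ring

theorem minBlocks_eq_zero_of_lt {r n : ℕ} (h : n < r) : minBlocks r n = 0 := by
  have hempty : completeHypergraph (Fin n) r = ∅ := by
    rw [Set.eq_empty_iff_forall_notMem]
    intro e he
    have h1 : e.card = r := he
    have h2 := Finset.card_le_univ e
    rw [Fintype.card_fin] at h2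
    omega
  refine Nat.le_zero.1 (minBlocks_le_of_hasDecomposition ?_)
  rw [hempty]
  exact HasDecomposition.empty r 0

theorem choose_le_multichoose (n : ℕ) {k : ℕ} (hk : k ≠ 0) : n.choose k ≤ n.multichoose k := by
  rw [Nat.multichoose_eq]
  exact Nat.choose_le_choose k (by omega)

theorem minBlocks_le_real {k N n : ℕ} (hk : k ≠ 0) (hN : N ≠ 0) :
    (minBlocks (2 * k) n : ℝ) ≤
      (N.choose k * (14 / 15 : ℝ) ^ (k / 2) + (N.multichoose k - N.choose k)) *
        ((n : ℝ) / N + 16) ^ k + N.multichoose (2 * k) * ((n : ℝ) / N + 16) ^ (k - 1) := by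
  set m := n / (15 * N) + 1 with hm
  have hNpos : 0 < N := Nat.pos_of_ne_zero hN
  have hn : n ≤ N * (15 * m + 1) := by
    have h1 : n < 15 * N * m := Nat.lt_mul_div_succ n (by omega)
    calc n ≤ 15 * N * m := h1.le
      _ ≤ N * (15 * m + 1) := by nlinarith
  have h := minBlocks_le k N m n hn
  -- The 16 is 15 + 1: `m` exceeds the rounded quotient by one, and a class has 15m + 1 vertices.
  have hL : (15 * m + 1 : ℝ) ≤ (n : ℝ) / N + 16 := by
    have h1 : ((n / (15 * N) : ℕ) : ℝ) ≤ (n : ℝ) / ((15 * N : ℕ) : ℝ) := Nat.cast_div_le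
    have h2 : (n : ℝ) / ((15 * N : ℕ) : ℝ) = (n : ℝ) / N / 15 := by
      push_cast
      rw [mul_comm, div_div]
    rw [h2] at h1
    rw [hm]
    push_cast
    linarith
  have hgood : ((210 : ℝ) * m ^ 2) ^ (k / 2) * (15 * m + 1) ^ (k % 2) ≤
      (14 / 15 : ℝ) ^ (k / 2) * (15 * m + 1) ^ k := by
    -- The left side is exactly 14/15 · (15m)².
    have h1 : (210 : ℝ) * m ^ 2 ≤ 14 / 15 * (15 * m + 1) ^ 2 := by
      have : (0 : ℝ) ≤ m := Nat.cast_nonneg m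
      nlinarith
    calc ((210 : ℝ) * m ^ 2) ^ (k / 2) * (15 * m + 1) ^ (k % 2)
        ≤ (14 / 15 * (15 * m + 1) ^ 2) ^ (k / 2) * (15 * m + 1) ^ (k % 2) := by gcongr
      _ = (14 / 15 : ℝ) ^ (k / 2) * (15 * m + 1) ^ (2 * (k / 2) + k % 2) := by
        rw [mul_pow, ← pow_mul, pow_add, mul_assoc]
      _ = (14 / 15 : ℝ) ^ (k / 2) * (15 * m + 1) ^ k := by rw [Nat.div_add_mod]
  have hD : (0 : ℝ) ≤ (N.multichoose k : ℝ) - N.choose k :=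
    sub_nonneg.2 (Nat.cast_le.2 (choose_le_multichoose N hk))
  calc (minBlocks (2 * k) n : ℝ)
      ≤ N.choose k * ((210 * m ^ 2) ^ (k / 2) * (15 * m + 1) ^ (k % 2)) +
        (N.multichoose k - N.choose k) * (15 * m + 1) ^ k +
        N.multichoose (2 * k) * (15 * m + 1) ^ (k - 1) := by
        rw [← Nat.cast_sub (choose_le_multichoose N hk)]
        exact_mod_cast h
    _ ≤ N.choose k * ((14 / 15 : ℝ) ^ (k / 2) * (15 * m + 1) ^ k) +
        (N.multichoose k - N.choose k) * (15 * m + 1) ^ k +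
        N.multichoose (2 * k) * (15 * m + 1) ^ (k - 1) := by gcongr
    _ = (N.choose k * (14 / 15 : ℝ) ^ (k / 2) + (N.multichoose k - N.choose k)) *
        (15 * m + 1) ^ k + N.multichoose (2 * k) * (15 * m + 1) ^ (k - 1) := by ring
    _ ≤ _ := by gcongr

/-! ### Asymptotics, for n and then for the number of classes. -/

theorem tendsto_choose_div_pow (k : ℕ) :
    Tendsto (fun n : ℕ => (n.choose k : ℝ) / n ^ k) atTop (𝓝 (1 / k.factorial)) := by
  have hne : ∀ᶠ n : ℕ in atTop, ((n : ℝ) ^ k / k.factorial) ≠ 0 := by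
    filter_upwards [eventually_ge_atTop 1] with n hn
    have : (n : ℝ) ≠ 0 := Nat.cast_ne_zero.2 (by omega)
    positivity
  have h := (Asymptotics.isEquivalent_iff_tendsto_one hne).1 (isEquivalent_choose k)
  have h2 := h.mul_const (1 / (k.factorial : ℝ))
  rw [one_mul] at h2
  refine h2.congr fun n => ?_
  have : (k.factorial : ℝ) ≠ 0 := Nat.cast_ne_zero.2 k.factorial_ne_zero
  simp only [Pi.div_apply]
  field_simp

theorem tendsto_multichoose_div_pow (k : ℕ) :
    Tendsto (fun n : ℕ => (n.multichoose k : ℝ) / n ^ k) atTop (𝓝 (1 / k.factorial)) := by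
  rcases Nat.eq_zero_or_pos k with rfl | hk
  · simp
  have h1 := (tendsto_choose_div_pow k).comp (tendsto_add_atTop_nat (k - 1))
  have h2 : Tendsto (fun n : ℕ => (((n + (k - 1) : ℕ) : ℝ) / n) ^ k) atTop (𝓝 (1 ^ k)) := by
    refine Tendsto.pow ?_ k
    have h3 : Tendsto (fun n : ℕ => 1 + ((k - 1 : ℕ) : ℝ) / n) atTop (𝓝 (1 + 0)) :=
      tendsto_const_nhds.add (tendsto_const_div_atTop_nhds_zero_nat _)
    rw [add_zero] at h3
    refine h3.congr' ?_
    filter_upwards [eventually_ge_atTop 1] with n hn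
    have : (n : ℝ) ≠ 0 := Nat.cast_ne_zero.2 (by omega)
    push_cast
    field_simp
  have h3 := h1.mul h2
  rw [one_pow, mul_one] at h3
  refine h3.congr' ?_
  filter_upwards [eventually_ge_atTop 1] with n hn
  have h4 : (n : ℝ) ≠ 0 := Nat.cast_ne_zero.2 (by omega)
  have h5 : ((n + (k - 1) : ℕ) : ℝ) ≠ 0 := Nat.cast_ne_zero.2 (by omega)
  rw [Function.comp_apply, Nat.multichoose_eq, Nat.add_sub_assoc hk, div_pow]
  field_simp

/-- With `N` fixed, the `T` term has degree k - 1 in n and vanishes in the limit. For k = 0 the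
truncated exponent would keep it alive. -/
theorem tendsto_bound_div_choose {k N : ℕ} (hk : k ≠ 0) (A T : ℝ) :
    Tendsto (fun n : ℕ => (A * ((n : ℝ) / N + 16) ^ k + T * ((n : ℝ) / N + 16) ^ (k - 1)) /
      n.choose k) atTop (𝓝 (A / N ^ k * k.factorial)) := by
  have hlin : Tendsto (fun n : ℕ => ((n : ℝ) / N + 16) / n) atTop (𝓝 (1 / N)) := by
    have h : Tendsto (fun n : ℕ => 1 / (N : ℝ) + 16 / n) atTop (𝓝 (1 / N + 0)) :=
      tendsto_const_nhds.add (tendsto_const_div_atTop_nhds_zero_nat 16)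
    rw [add_zero] at h
    refine h.congr' ?_
    filter_upwards [eventually_ge_atTop 1] with n hn
    have : (n : ℝ) ≠ 0 := Nat.cast_ne_zero.2 (by omega)
    rw [add_div, div_right_comm, div_self this]
  have hnum : Tendsto (fun n : ℕ => A * (((n : ℝ) / N + 16) / n) ^ k +
      T * (((n : ℝ) / N + 16) / n) ^ (k - 1) * (1 / n)) atTop
      (𝓝 (A * (1 / N) ^ k + T * (1 / N) ^ (k - 1) * 0)) :=
    ((hlin.pow k).const_mul A).add
      (((hlin.pow (k - 1)).const_mul T).mul (tendsto_const_div_atTop_nhds_zero_nat 1))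
  have hfac : (1 / (k.factorial : ℝ)) ≠ 0 :=
    one_div_ne_zero (Nat.cast_ne_zero.2 k.factorial_ne_zero)
  have h := hnum.div (tendsto_choose_div_pow k) hfac
  have hlim : (A * (1 / N) ^ k + T * (1 / N) ^ (k - 1) * 0) / (1 / (k.factorial : ℝ)) =
      A / N ^ k * k.factorial := by
    rw [mul_zero, add_zero, div_div_eq_mul_div, div_one, one_div, inv_pow, div_eq_mul_inv]
  rw [hlim] at h
  refine h.congr' ?_
  filter_upwards [eventually_ge_atTop 1] with n hn
  have hn0 : (n : ℝ) ≠ 0 := Nat.cast_ne_zero.2 (by omega)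
  obtain ⟨j, rfl⟩ := Nat.exists_eq_succ_of_ne_zero hk
  rw [Pi.div_apply, Nat.succ_sub_one, div_pow, div_pow]
  rw [show A * (((n : ℝ) / N + 16) ^ j.succ / n ^ j.succ) +
      T * (((n : ℝ) / N + 16) ^ j / n ^ j) * (1 / n) =
      (A * ((n : ℝ) / N + 16) ^ j.succ + T * ((n : ℝ) / N + 16) ^ j) / n ^ j.succ by
    rw [Nat.succ_eq_add_one, pow_succ (n : ℝ) j]
    field_simp]
  rw [div_div_div_cancel_right₀ (pow_ne_zero _ hn0)]

/-- `N.choose k` and `N.multichoose k` are both asymptotic to N^k / k!, so the even types with some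
entry above 2 contribute nothing in the limit. -/
theorem tendsto_leading_constant (k : ℕ) (b : ℝ) :
    Tendsto (fun N : ℕ => (N.choose k * b + (N.multichoose k - N.choose k)) / (N : ℝ) ^ k *
      k.factorial) atTop (𝓝 b) := by
  have h := ((((tendsto_choose_div_pow k).mul_const b).add
    ((tendsto_multichoose_div_pow k).sub (tendsto_choose_div_pow k))).mul_const
      (k.factorial : ℝ))
  have hfac : (k.factorial : ℝ) ≠ 0 := Nat.cast_ne_zero.2 k.factorial_ne_zero
  have hlim : (1 / (k.factorial : ℝ) * b + (1 / k.factorial - 1 / k.factorial)) *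
      k.factorial = b := by
    field_simp
    ring
  rw [hlim] at h
  refine h.congr fun N => ?_
  ring

theorem eventually_minBlocks_div_choose_lt {k : ℕ} (hk : k ≠ 0) {d : ℝ}
    (hd : (14 / 15 : ℝ) ^ (k / 2) < d) :
    ∀ᶠ n : ℕ in atTop, (minBlocks (2 * k) n : ℝ) / n.choose k < d := by
  -- One suitable `N` is fixed before n grows, so `N` need not depend on n.
  obtain ⟨N, hN, hN0⟩ := (((tendsto_leading_constant k _).eventually_lt_const hd).and
    (eventually_ne_atTop 0)).exists
  filter_upwards [(tendsto_bound_div_choose (N := N) hk _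
    (N.multichoose (2 * k) : ℝ)).eventually_lt_const hN] with n hn
  exact (div_le_div_of_nonneg_right (minBlocks_le_real hk hN0) (Nat.cast_nonneg _)).trans_lt hn

theorem theorem1 (r : ℕ) (hr : 6 ≤ r) (heven : Even r) :
    ∃ δ : ℕ → ℝ, Tendsto δ atTop (𝓝 0) ∧
      ∀ n : ℕ, (minBlocks r n : ℝ) ≤
        (14 / 15 : ℝ) ^ ((r : ℝ) / 6) * (1 + δ n) * (n.choose (r / 2) : ℝ) := by
  obtain ⟨k, rfl⟩ := even_iff_exists_two_mul.1 heven
  have hk : k ≠ 0 := by omega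
  rw [Nat.mul_div_cancel_left k two_pos]
  set c := (14 / 15 : ℝ) ^ (((2 * k : ℕ) : ℝ) / 6) with hc
  have hc0 : 0 < c := Real.rpow_pos_of_pos (by norm_num) _
  have hqc : (14 / 15 : ℝ) ^ (k / 2) ≤ c := by
    rw [hc, ← Real.rpow_natCast]
    refine Real.rpow_le_rpow_of_exponent_ge (by norm_num) (by norm_num) ?_
    -- This fails only for k = 1 and is an equality at k = 3, that is r = 6. As the base 14/15 is
    -- below 1, a larger exponent gives a smaller power.
    have h : k ≤ 3 * (k / 2) := by omega
    have h' : (k : ℝ) ≤ 3 * ((k / 2 : ℕ) : ℝ) := by exact_mod_cast h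
    push_cast at h' ⊢
    linarith
  -- Only an upper bound on the ratio is known, so it need not tend to `c`; cutting off at 0 makes
  -- the error tend to 0.
  refine ⟨fun n => max 0 ((minBlocks (2 * k) n : ℝ) / n.choose k / c - 1), ?_, fun n => ?_⟩
  · rw [tendsto_order]
    refine ⟨fun a ha => Eventually.of_forall fun n => ha.trans_le (le_max_left _ _),
      fun a ha => ?_⟩
    have hd : (14 / 15 : ℝ) ^ (k / 2) < (1 + a) * c := by nlinarith
    filter_upwards [eventually_minBlocks_div_choose_lt hk hd] with n hn
    refine max_lt ha ?_
    rw [sub_lt_iff_lt_add', div_lt_iff₀ hc0]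
    exact hn
  · rcases Nat.eq_zero_or_pos (n.choose k) with h0 | h0
    · rw [minBlocks_eq_zero_of_lt (by have := Nat.choose_eq_zero_iff.1 h0; omega), h0]
      simp
    · have hC : (0 : ℝ) < n.choose k := Nat.cast_pos.2 h0
      calc (minBlocks (2 * k) n : ℝ)
          = c * (1 + ((minBlocks (2 * k) n : ℝ) / n.choose k / c - 1)) * n.choose k := by
            field_simp
            ring
        _ ≤ _ := by
            gcongr
            exact le_max_right _ _
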